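/- Let $d \ge 0$. An \emph{affine semigroup} in $\mathbb{Z}^d$ is a finitely generated submonoid of $\mathbb{Z}^d$. An \emph{affine stratification} of a subset $W \subseteq \mathbb{Z}^d$ is an expression $W = W_1 \uplus \cdots \uplus W_r$ of $W$ as a finite disjoint union of sets such that, for each $i$, $W_i = F_i + A_i$ for some finite set $F_i \subseteq \mathbb{Z}^d$ and some affine semigroup $A_i \subseteq \mathbb{Z}^d$ (both depending on $i$). If each of finitely many given subsets of $\mathbb{Z}^d$ possesses an affine stratification, then so does their union. -/

import Mathlib

open scoped Pointwise

/-- An affine semigroup in `ℤ^d`: a finitely generated submonoid of the free abelian group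
`ℤ^d`. -/
def IsAffineSemigroup {d : ℕ} (A : AddSubmonoid (Fin d → ℤ)) : Prop :=
  A.FG

/-- A subset `W` of `ℤ^d` is a finitely generated module for the submonoid `A` of `ℤ^d` if
`W = F + A` (Minkowski sum) for some finite set `F ⊆ ℤ^d`. -/
def IsFinGenModuleFor {d : ℕ} (A : AddSubmonoid (Fin d → ℤ)) (W : Set (Fin d → ℤ)) : Prop :=
  ∃ F : Set (Fin d → ℤ), F.Finite ∧ W = F + (A : Set (Fin d → ℤ))

/-- An affine stratification of a subset `W` of `ℤ^d`: a decomposition of `W` into finitely many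
pairwise disjoint sets, each of which is a finitely generated module for an affine semigroup (which
may vary with the stratum). -/
structure AffineStratification {d : ℕ} (W : Set (Fin d → ℤ)) where
  /-- the number of strata -/
  r : ℕ
  /-- the strata -/
  stratum : Fin r → Set (Fin d → ℤ)
  /-- the affine semigroups acting on the strata -/
  semigroup : Fin r → AddSubmonoid (Fin d → ℤ)
  isAffineSemigroup : ∀ i, IsAffineSemigroup (semigroup i)
  isFinGenModuleFor : ∀ i, IsFinGenModuleFor (semigroup i) (stratum i)
  pairwise_disjoint : ∀ i j, i ≠ j → Disjoint (stratum i) (stratum j)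
  eq_iUnion : W = ⋃ i, stratum i

/-- `W` possesses an affine stratification. -/
def HasAffineStratification {d : ℕ} (W : Set (Fin d → ℤ)) : Prop :=
  Nonempty (AffineStratification W)

/-! Disjointness is the only obstacle, so strata are traded for a description stable under union. A
stratified set is semilinear, hence so is the union, which is then a finite union of translates `a +
ℕt` with `t` linearly independent (proper linear sets). Membership in each is decided by finitely
many inequalities and congruences on integer functionals. Pooling these tests over all the pieces,
the union is a union of classes of points with equal test results. There are finitely many classes,
they are disjoint, and each is `F + A` by Gordan's and Dickson's lemmas. -/

section SignResidue

variable {M : Type*} [AddCommGroup M]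

/-- The elements of the subgroup `L` on which all the functionals `g k` are nonnegative. -/
def nonnegPart {κ : Type*} (L : AddSubgroup M) (g : κ → M →+ ℤ) : AddSubmonoid M where
  carrier := {z | z ∈ L ∧ ∀ k, 0 ≤ g k z}
  zero_mem' := by simp [zero_mem]
  add_mem' := fun {a b} ha hb =>
    ⟨add_mem ha.1 hb.1, fun k => by rw [map_add]; exact add_nonneg (ha.2 k) (hb.2 k)⟩

theorem mem_nonnegPart {κ : Type*} {L : AddSubgroup M} {g : κ → M →+ ℤ} {z : M} :
    z ∈ nonnegPart L g ↔ z ∈ L ∧ ∀ k, 0 ≤ g k z := Iff.rfl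

/-- Gordan's lemma. -/
theorem nonnegPart_fg [AddMonoid.FG M] {κ : Type*} [Finite κ] (L : AddSubgroup M)
    (g : κ → M →+ ℤ) : (nonnegPart L g).FG := by
  obtain ⟨n, π, hπ⟩ := (AddSubmonoid.fg_iff_exists_fin_addMonoidHom (S := (⊤ : AddSubmonoid M))).1
    (AddMonoid.FG.fg_top)
  rw [AddMonoidHom.mrange_eq_top] at hπ
  -- The coordinates in `κ` are slack variables: they turn inequalities into equations, making `Q`
  -- subtractive and hence finitely generated.
  let Q : AddSubmonoid (Fin n ⊕ κ → ℕ) :=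
    { carrier := {p | π (p ∘ Sum.inl) ∈ L ∧ ∀ k, g k (π (p ∘ Sum.inl)) = p (Sum.inr k)}
      zero_mem' := by
        have : ((0 : Fin n ⊕ κ → ℕ) ∘ Sum.inl) = (0 : Fin n → ℕ) := rfl
        simp [this, zero_mem]
      add_mem' := by
        rintro a b ⟨ha, ha'⟩ ⟨hb, hb'⟩
        have : (a + b) ∘ (Sum.inl : Fin n → Fin n ⊕ κ) = a ∘ Sum.inl + b ∘ Sum.inl := rfl
        refine ⟨?_, fun k => ?_⟩
        · rw [this, map_add]; exact add_mem ha hb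
        · rw [this, map_add, map_add, ha', hb']; simp }
  have hQ : Q.FG := by
    refine AddSubmonoid.fg_of_subtractive ?_
    rintro a ⟨ha, ha'⟩ b ⟨hb, hb'⟩
    have : (a + b) ∘ (Sum.inl : Fin n → Fin n ⊕ κ) = a ∘ Sum.inl + b ∘ Sum.inl := rfl
    rw [this, map_add] at hb
    refine ⟨(add_mem_cancel_left ha).1 hb, fun k => ?_⟩
    have h := hb' k
    rw [this, map_add, map_add, ha', Pi.add_apply, Nat.cast_add] at h
    exact add_left_cancel h
  let q : (Fin n ⊕ κ → ℕ) →+ M :=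
    { toFun := fun p => π (p ∘ Sum.inl)
      map_zero' := map_zero π
      map_add' := fun a b => map_add π (a ∘ Sum.inl) (b ∘ Sum.inl) }
  convert hQ.map q
  ext z
  rw [mem_nonnegPart, AddSubmonoid.mem_map]
  constructor
  · rintro ⟨hz, hz'⟩
    obtain ⟨u, rfl⟩ := hπ z
    refine ⟨Sum.elim u fun k => (g k (π u)).toNat, ⟨by simpa using hz, fun k => ?_⟩, ?_⟩
    · simp [Int.toNat_of_nonneg (hz' k)]
    · simp [q]
  · rintro ⟨p, ⟨hp, hp'⟩, rfl⟩
    exact ⟨hp, fun k => by simp [q, hp']⟩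

/-- Dickson's lemma: `φ` has finitely many minimal values on `C`, and one preimage of each suffices
for `F`. -/
theorem exists_finite_add_eq {κ : Type*} [Finite κ] {C : Set M} {A : AddSubmonoid M}
    (φ : M → κ → ℕ) (hsub : ∀ x ∈ C, ∀ y ∈ C, φ x ≤ φ y → y - x ∈ A)
    (hadd : ∀ x ∈ C, ∀ z ∈ A, x + z ∈ C) :
    ∃ F : Set M, F.Finite ∧ C = F + (A : Set M) := by
  have hpwo := Set.isPWO_of_wellQuasiOrderedLE (φ '' C)
  have hfin : {v | Minimal (· ∈ φ '' C) v}.Finite :=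
    WellQuasiOrderedLE.finite_of_isAntichain (setOfPred_minimal_antichain _)
  have hmin : ∀ v ∈ {v | Minimal (· ∈ φ '' C) v}, ∃ x ∈ C, φ x = v := fun v hv => hv.1
  choose! s hs hs' using hmin
  refine ⟨s '' {v | Minimal (· ∈ φ '' C) v}, hfin.image s, ?_⟩
  ext y
  rw [Set.mem_add]
  constructor
  · intro hy
    obtain ⟨v, hv, hvm⟩ := hpwo.exists_le_minimal (Set.mem_image_of_mem φ hy)
    refine ⟨s v, ⟨v, hvm, rfl⟩, y - s v, hsub _ (hs v hvm) _ hy ?_, by abel⟩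
    rwa [hs' v hvm]
  · rintro ⟨_, ⟨v, hv, rfl⟩, z, hz, rfl⟩
    exact hadd _ (hs v hv) _ hz

/-- Equivalence of two elements with respect to the sign and residue test `p = (f, b, m)`:
`f` is at least `b` at both elements or at neither, and its values agree modulo `m`. -/
def SignResidueEq (p : (M →+ ℤ) × ℤ × ℕ) (x y : M) : Prop :=
  (p.2.1 ≤ p.1 x ↔ p.2.1 ≤ p.1 y) ∧ p.1 x ≡ p.1 y [ZMOD p.2.2]

/-- Membership in `W` is determined by finitely many comparisons and residues of integer
functionals. -/
def IsSignResidueSet (W : Set M) : Prop :=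
  ∃ S : Set ((M →+ ℤ) × ℤ × ℕ), S.Finite ∧ (∀ p ∈ S, p.2.2 ≠ 0) ∧
    ∀ x y, (∀ p ∈ S, SignResidueEq p x y) → x ∈ W → y ∈ W

theorem IsSignResidueSet.iUnion {ι : Type*} [Finite ι] {W : ι → Set M}
    (hW : ∀ i, IsSignResidueSet (W i)) : IsSignResidueSet (⋃ i, W i) := by
  choose S hS hm h using hW
  refine ⟨⋃ i, S i, Set.finite_iUnion hS, ?_, ?_⟩
  · intro p hp
    obtain ⟨i, hi⟩ := Set.mem_iUnion.1 hp
    exact hm i p hi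
  · intro x y hxy hx
    obtain ⟨i, hi⟩ := Set.mem_iUnion.1 hx
    exact Set.mem_iUnion.2 ⟨i, h i x y (fun p hp => hxy p (Set.mem_iUnion.2 ⟨i, hp⟩)) hi⟩

theorem IsSignResidueSet.sUnion {S : Set (Set M)} (hS : S.Finite)
    (h : ∀ s ∈ S, IsSignResidueSet s) : IsSignResidueSet (⋃₀ S) := by
  have := hS.to_subtype
  rw [Set.sUnion_eq_iUnion]
  exact .iUnion fun s => h s s.2

theorem exists_fg_add_eq_signResidueClass [AddMonoid.FG M] {S : Set ((M →+ ℤ) × ℤ × ℕ)}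
    (hS : S.Finite) (x : M) :
    ∃ (F : Set M) (A : AddSubmonoid M), F.Finite ∧ A.FG ∧
      {y | ∀ p ∈ S, SignResidueEq p x y} = F + (A : Set M) := by
  classical
  have := hS.to_subtype
  let σ : S → ℤ := fun p => if p.1.2.1 ≤ p.1.1 x then 1 else -1
  -- Over the integers `¬ b ≤ f` means `1 - b ≤ -f`, so every test becomes a lower bound.
  let β : S → ℤ := fun p => if p.1.2.1 ≤ p.1.1 x then p.1.2.1 else 1 - p.1.2.1
  have hσ : ∀ (p : S) (y : M),
      (p.1.2.1 ≤ p.1.1 x ↔ p.1.2.1 ≤ p.1.1 y) ↔ β p ≤ σ p * p.1.1 y := by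
    intro p y
    simp only [σ, β]
    split_ifs with h
    · simp [h]
    · simp only [h, false_iff]; lia
  let L : AddSubgroup M := ⨅ p : S, (AddSubgroup.zmultiples (p.1.2.2 : ℤ)).comap p.1.1
  have hL : ∀ z, z ∈ L ↔ ∀ p : S, (p.1.2.2 : ℤ) ∣ p.1.1 z := fun z => by
    simp [L, AddSubgroup.mem_iInf, Int.mem_zmultiples_iff]
  let g : S → M →+ ℤ := fun p => σ p • p.1.1
  have hg : ∀ p z, g p z = σ p * p.1.1 z := fun p z => by simp [g]
  have hC : ∀ y, (∀ p ∈ S, SignResidueEq p x y) ↔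
      ∀ p : S, β p ≤ g p y ∧ p.1.1 x ≡ p.1.1 y [ZMOD p.1.2.2] := fun y => by
    simp only [hg, ← hσ, SignResidueEq, Subtype.forall]
  suffices h : ∃ F : Set M, F.Finite ∧
      {y | ∀ p ∈ S, SignResidueEq p x y} = F + (nonnegPart L g : Set M) by
    obtain ⟨F, hF, h⟩ := h
    exact ⟨F, _, hF, nonnegPart_fg L g, h⟩
  refine exists_finite_add_eq (fun y p => (g p y - β p).toNat) ?_ ?_
  · intro y hy z hz hyz
    rw [Set.mem_ofPred_eq, hC] at hy hz
    refine mem_nonnegPart.2 ⟨(hL _).2 fun p => ?_, fun p => ?_⟩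
    · rw [map_sub]
      exact ((hy p).2.symm.trans (hz p).2).dvd
    · have h1 := (hy p).1
      have h2 := (hz p).1
      have h3 := hyz p
      simp only at h3
      rw [map_sub]
      lia
  · intro y hy z hz
    rw [Set.mem_ofPred_eq, hC] at hy ⊢
    intro p
    refine ⟨?_, ?_⟩
    · rw [map_add]
      linarith [(hy p).1, hz.2 p]
    · refine (hy p).2.trans ?_
      rw [map_add, Int.modEq_iff_dvd, add_sub_cancel_left]
      exact (hL z).1 hz.1 p

end SignResidue

theorem IsSignResidueSet.hasAffineStratification {d : ℕ} {W : Set (Fin d → ℤ)}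
    (hW : IsSignResidueSet W) : HasAffineStratification W := by
  obtain ⟨S, hS, hm, h⟩ := hW
  have := hS.to_subtype
  have : ∀ p : S, NeZero p.1.2.2 := fun p => ⟨hm p p.2⟩
  let Φ : (Fin d → ℤ) → ∀ p : S, Prop × ZMod p.1.2.2 :=
    fun x p => (p.1.2.1 ≤ p.1.1 x, (p.1.1 x : ZMod p.1.2.2))
  have hΦ : ∀ x y, Φ x = Φ y ↔ ∀ p ∈ S, SignResidueEq p x y := fun x y => by
    simp only [Φ, funext_iff, Prod.mk.injEq, eq_iff_iff, ZMod.intCast_eq_intCast_iff,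
      SignResidueEq, Subtype.forall]
  have key : ∀ u, ∃ (A : AddSubmonoid (Fin d → ℤ)),
      A.FG ∧ IsFinGenModuleFor A (W ∩ Φ ⁻¹' {u}) := by
    intro u
    obtain he | ⟨x, hxW, rfl⟩ := (W ∩ Φ ⁻¹' {u}).eq_empty_or_nonempty
    -- Empty strata are allowed, with `F = ∅`.
    · exact ⟨⊥, AddSubmonoid.FG.bot, ∅, Set.finite_empty, by rw [he, Set.empty_add]⟩
    · obtain ⟨F, A, hF, hA, hFA⟩ := exists_fg_add_eq_signResidueClass hS x
      refine ⟨A, hA, F, hF, ?_⟩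
      rw [← hFA]
      ext y
      have := hΦ x y
      have := h x y
      simp only [Set.mem_inter_iff, Set.mem_preimage, Set.mem_singleton_iff, Set.mem_ofPred_eq]
      grind
  choose A hA hF using key
  let e := Finite.equivFin (∀ p : S, Prop × ZMod p.1.2.2)
  refine ⟨{
    r := _
    stratum := fun i => W ∩ Φ ⁻¹' {e.symm i}
    semigroup := fun i => A (e.symm i)
    isAffineSemigroup := fun i => hA _
    isFinGenModuleFor := fun i => hF _
    pairwise_disjoint := ?_
    eq_iUnion := ?_ }⟩
  · intro i j hij
    rw [Set.disjoint_left]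
    rintro x ⟨-, hi⟩ ⟨-, hj⟩
    exact hij (e.symm.injective (hi.symm.trans hj))
  · ext x
    simp only [Set.mem_iUnion, Set.mem_inter_iff, Set.mem_preimage, Set.mem_singleton_iff]
    exact ⟨fun hx => ⟨e (Φ x), hx, by simp⟩, fun ⟨_, hx, _⟩ => hx⟩

theorem HasAffineStratification.isSemilinearSet {d : ℕ} {W : Set (Fin d → ℤ)}
    (hW : HasAffineStratification W) : IsSemilinearSet W := by
  obtain ⟨s⟩ := hW
  rw [s.eq_iUnion]
  refine .iUnion fun i => ?_
  obtain ⟨F, hF, h⟩ := s.isFinGenModuleFor i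
  rw [h]
  exact (IsSemilinearSet.of_finite hF).add (.of_fg (s.isAffineSemigroup i))

open Matrix in
/-- An injective integer matrix has a left inverse up to a positive integer factor. -/
theorem exists_mul_eq_smul_one_of_mulVec_injective {m n : Type*} [Fintype m] [Fintype n]
    [DecidableEq n] (T : Matrix m n ℤ) (hT : ∀ v, T *ᵥ v = 0 → v = 0) :
    ∃ (L : Matrix n m ℤ) (c : ℕ), c ≠ 0 ∧ L * T = (c : ℤ) • 1 := by
  -- If `TᵀTv = 0`, then `Tv · Tv = 0`, so `Tv = 0`. The left inverse comes from the adjugate of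
  -- this Gram matrix.
  have hdet : (Tᵀ * T).det ≠ 0 := by
    intro h
    obtain ⟨v, hv, hv0⟩ := Matrix.exists_mulVec_eq_zero_iff.2 h
    refine hv (hT v ?_)
    have := congrArg (dotProduct v) hv0
    rwa [← mulVec_mulVec, dotProduct_mulVec, dotProduct_zero, vecMul_transpose,
      dotProduct_self_eq_zero] at this
  refine ⟨(Tᵀ * T).det.sign • ((Tᵀ * T).adjugate * Tᵀ), (Tᵀ * T).det.natAbs,
    Int.natAbs_ne_zero.2 hdet, ?_⟩
  rw [Matrix.smul_mul, Matrix.mul_assoc, Matrix.adjugate_mul, smul_smul, Int.sign_mul_self]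

/-- Splitting the coefficients into positive and negative parts turns a relation over `ℤ` into an
equality of two combinations over `ℕ`. -/
theorem eq_zero_of_sum_zsmul_eq_zero_of_linearIndepOn_nat {d : ℕ} {t : Finset (Fin d → ℤ)}
    (ht : LinearIndepOn ℕ id (t : Set (Fin d → ℤ))) (f : t → ℤ)
    (hf : ∑ i, f i • (i : Fin d → ℤ) = 0) : f = 0 := by
  have := (Fintype.linearIndependent_iffₛ (R := ℕ) (v := fun i : t => (i : Fin d → ℤ))).1 ht
    (fun i => (f i).toNat) (fun i => (-f i).toNat) ?_
  · ext i
    have := this i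
    simp only [Pi.zero_apply]
    lia
  · rw [← sub_eq_zero, ← Finset.sum_sub_distrib, ← hf]
    refine Finset.sum_congr rfl fun i _ => ?_
    rw [← natCast_zsmul, ← natCast_zsmul, ← sub_smul, Int.toNat_sub_toNat_neg]

open Matrix in
theorem IsProperLinearSet.isSignResidueSet {d : ℕ} {W : Set (Fin d → ℤ)}
    (hW : IsProperLinearSet W) : IsSignResidueSet W := by
  classical
  obtain ⟨a, t, ht, rfl⟩ := isProperLinearSet_iff.1 hW
  let T : Matrix (Fin d) t ℤ := .of fun i j => j.1 i
  have hTv : ∀ v : t → ℤ, T *ᵥ v = ∑ j, v j • (j : Fin d → ℤ) := fun v => by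
    ext i
    simp [T, mulVec, dotProduct, mul_comm]
  obtain ⟨L, c, hc, hL⟩ := exists_mul_eq_smul_one_of_mulVec_injective T fun v hv =>
    eq_zero_of_sum_zsmul_eq_zero_of_linearIndepOn_nat ht v (by rw [← hTv, hv])
  -- The last equation puts `x - a` in the rational span of `t`; its coefficients are then `L (x -
  -- a) / c`, which must be natural numbers.
  have hmem : ∀ x, x ∈ a +ᵥ (AddSubmonoid.closure (t : Set (Fin d → ℤ)) : Set (Fin d → ℤ)) ↔
      (∀ j, (L *ᵥ a) j ≤ (L *ᵥ x) j ∧ (c : ℤ) ∣ (L *ᵥ x) j - (L *ᵥ a) j) ∧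
        T *ᵥ L *ᵥ x - (c : ℤ) • x = T *ᵥ L *ᵥ a - (c : ℤ) • a := by
    intro x
    have hsub : ∀ j, (L *ᵥ x) j - (L *ᵥ a) j = (L *ᵥ (x - a)) j := fun j => by
      rw [mulVec_sub, Pi.sub_apply]
    have hT : T *ᵥ L *ᵥ x - (c : ℤ) • x = T *ᵥ L *ᵥ a - (c : ℤ) • a ↔
        T *ᵥ L *ᵥ (x - a) = (c : ℤ) • (x - a) := by
      rw [mulVec_sub, mulVec_sub, smul_sub, ← sub_eq_zero, ← sub_eq_zero (b := _ - _)]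
      abel_nf
    rw [hT, Set.mem_vadd_set_iff_neg_vadd_mem, vadd_eq_add, neg_add_eq_sub, SetLike.mem_coe,
      AddSubmonoid.mem_closure_finset']
    simp_rw [hsub, ← sub_nonneg (b := (L *ᵥ a) _), hsub]
    generalize x - a = y
    constructor
    · rintro ⟨n, hn⟩
      have hy : y = T *ᵥ (fun j => (n j : ℤ)) := by simp [hn, hTv]
      have hLy : L *ᵥ y = (c : ℤ) • fun j => (n j : ℤ) := by
        rw [hy, mulVec_mulVec, hL, smul_mulVec, one_mulVec]
      refine ⟨fun j => ?_, ?_⟩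
      · rw [hLy]
        exact ⟨by simp; positivity, Dvd.intro _ rfl⟩
      · rw [hLy, mulVec_smul, ← hy]
    · rintro ⟨h1, h2⟩
      choose h0 q hq using h1
      have hLy : L *ᵥ y = (c : ℤ) • q := funext hq
      rw [hLy, mulVec_smul] at h2
      have hy := smul_right_injective (Fin d → ℤ) (Int.natCast_ne_zero.2 hc) h2
      refine ⟨fun j => (q j).toNat, ?_⟩
      rw [← hy, hTv]
      refine Finset.sum_congr rfl fun j _ => ?_
      have hqj : 0 ≤ q j := by
        have := h0 j
        rw [hq] at this
        exact nonneg_of_mul_nonneg_right this (by positivity)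
      rw [← natCast_zsmul, Int.toNat_of_nonneg hqj]
  let f : t → (Fin d → ℤ) →+ ℤ := fun j =>
    (LinearMap.proj j ∘ₗ L.mulVecLin).toAddMonoidHom
  let h : Fin d → (Fin d → ℤ) →+ ℤ := fun i =>
    (LinearMap.proj i ∘ₗ ((T * L).mulVecLin - (c : ℤ) • LinearMap.id)).toAddMonoidHom
  have hf : ∀ j x, f j x = (L *ᵥ x) j := fun _ _ => rfl
  have hh : ∀ i x, h i x = (T *ᵥ L *ᵥ x - (c : ℤ) • x) i := fun i x => by
    rw [mulVec_mulVec]; rfl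
  -- Each equation `h i x = h i a` is encoded as two opposite inequalities, with the vacuous modulus
  -- `1`.
  refine ⟨Set.range (fun j => (f j, f j a, c)) ∪ Set.range (fun i => (h i, h i a, 1)) ∪
    Set.range (fun i => (-h i, -h i a, 1)),
    ((Set.finite_range _).union (Set.finite_range _)).union (Set.finite_range _), ?_, ?_⟩
  · rintro p ((⟨j, rfl⟩ | ⟨j, rfl⟩) | ⟨j, rfl⟩)
    exacts [hc, one_ne_zero, one_ne_zero]
  · intro x y hxy hx
    rw [hmem] at hx ⊢
    refine ⟨fun j => ?_, ?_⟩
    · obtain ⟨h1, h2⟩ := hxy _ (.inl (.inl ⟨j, rfl⟩))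
      simp only [hf] at h1 h2
      refine ⟨h1.1 (hx.1 j).1, ?_⟩
      simpa using dvd_add h2.dvd (hx.1 j).2
    · ext i
      have h1 := (hxy _ (.inl (.inr ⟨i, rfl⟩))).1
      have h2 := (hxy _ (.inr ⟨i, rfl⟩)).1
      have h3 := congrFun hx.2 i
      simp only [AddMonoidHom.neg_apply, neg_le_neg_iff] at h1 h2
      rw [← hh, ← hh] at h3 ⊢
      lia

theorem corollaryc {d : ℕ} {ι : Type*} [Finite ι] (W : ι → Set (Fin d → ℤ))
    (hW : ∀ i, HasAffineStratification (W i)) :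
    HasAffineStratification (⋃ i, W i) := by
  obtain ⟨S, hS, hS', h⟩ :=
    (IsSemilinearSet.iUnion fun i => (hW i).isSemilinearSet).isProperSemilinearSet
  rw [h]
  exact (IsSignResidueSet.sUnion hS fun s hs =>
    (hS' s hs).isSignResidueSet).hasAffineStratification
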